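/- **Setting.** Let $\mathbb X,\mathbb Y,\mathbb W$ be finite-dimensional Euclidean spaces, $\mathcal A:\mathbb X\to\mathbb W$ and $\mathcal B:\mathbb X\to\mathbb Y$ linear maps, $\mathcal Q\subseteq\mathbb Y$ a (nonempty) closed convex cone with polar cone $\mathcal Q^\circ=\{y:\langle y,d\rangle\le 0\ \forall d\in\mathcal Q\}$, $c\in\mathbb X$, $b\in\mathbb Y$, $p:\mathbb X\to(-\infty,+\infty]$ proper closed convex, and $h:\mathbb W\to(-\infty,+\infty]$ proper closed convex and essentially smooth with $\nabla h$ locally Lipschitz continuous on $\operatorname{int}(\operatorname{dom}h)$. Consider the convex composite conic program $$\text{(P)}\qquad \min\ f^0(x):=h(\mathcal Ax)+\langle c,x\rangle+p(x)\quad\text{s.t.}\quad \mathcal Bx\in b+\mathcal Q,$$ and its Lagrangian dual $$\text{(D)}\qquad \max\ g^0(y):=\inf_{x\in\mathbb X} l(x,y)\quad\text{s.t.}\quad y\in\mathcal Q^\circ ,$$ where $l(x,y)=f^0(x)+\langle y,\mathcal Bx-b\rangle$ if $x\in\operatorname{dom}f^0$ and $y\in\mathcal Q^\circ$, $l(x,y)=-\infty$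 if $x\in\operatorname{dom}f^0$ and $y\notin\mathcal Q^\circ$, and $l(x,y)=+\infty$ if $x\notin\operatorname{dom}f^0$. Let $\mathrm{SOL}_D$ be the set of optimal solutions of (D), and assume that the KKT system $0\in\mathcal A^*\nabla h(\mathcal Ax)+c+\partial p(x)+\mathcal B^*y$, $y\in\mathcal N_{\mathcal Q}(\mathcal Bx-b)$ has at least one solution $(x,y)$. Let $\Pi_{\mathcal Q^\circ}$ be the Euclidean projection onto $\mathcal Q^\circ$ and, for $\sigma>0$, $$L_\sigma(x,y)=f^0(x)+\tfrac1{2\sigma}\bigl(\|\Pi_{\mathcal Q^\circ}[y+\sigma(\mathcal Bx-b)]\|^2-\|y\|^2\bigr).$$ Let $(\sigma_k)_{k\ge0}$ be a nondecreasing sequence of positive numbers with limit $\sigma_\infty\le+\infty$, and let $\{(x^k,y^k)\}$ be an infinite sequence with $y^0\in\mathcal Q^\circ$ and $y^{k+1}=\Pi_{\mathcal Q^\circ}[y^k+\sigma_k(\mathcal Bx^{k+1}-b)]$ for all $k\ge0$ (the augmented Lagrangian method), where $x^{k+1}$ approximately minimizes $f_k:=L_{\sigma_k}(\cdot,y^k)$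 in the sense of some of the criteria * (A') $f_k(x^{k+1})-\inf f_k\le\varepsilon_k^2/(2\sigma_k)$ for all $k$, with $\varepsilon_k\ge0$, $\sum_k\varepsilon_k<\infty$; * (B') $f_k(x^{k+1})-\inf f_k\le(\eta_k^2/(2\sigma_k))\|y^{k+1}-y^k\|^2$ for all $k$, with $0\le\eta_k<1$, $\sum_k\eta_k<\infty$. The dual quadratic growth condition with modulus $\kappa>0$ holds at $\bar y\in\mathrm{SOL}_D$ if for some $\varepsilon>0$, $-g^0(y)\ge-\sup(\mathrm D)+\kappa\,\operatorname{dist}^2(y,\mathrm{SOL}_D)$ for all $y\in\mathcal Q^\circ$ with $g^0(y)>-\infty$ and $\|y-\bar y\|\le\varepsilon$. **Theorem 1.** Under criterion (A'), the sequence $\{y^k\}$ is bounded and converges to some $y^\infty\in\mathrm{SOL}_D$. If criterion (B') is satisfied as well and the dual quadratic growth condition holds at $y^\infty$ with modulus $\kappa_g$, then there exists $\bar k\ge0$ such that for all $k\ge\bar k$, $$\begin{aligned} \operatorname{dist}(y^{k+1},\mathrm{SOL}_D)&\le\mu_k\operatorname{dist}(y^k,\mathrm{SOL}_D),\\ \|\Pi_{\mathcal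 Q^\circ}(\mathcal Bx^{k+1}-b)\|&\le\mu_k'\operatorname{dist}(y^k,\mathrm{SOL}_D),\\ |\langle y^{k+1},\mathcal Bx^{k+1}-b\rangle|&\le\mu_k''\operatorname{dist}(y^k,\mathrm{SOL}_D),\\ f^0(x^{k+1})-\inf(\mathrm P)&\le\mu_k'''\operatorname{dist}(y^k,\mathrm{SOL}_D), \end{aligned}$$ where $$\begin{aligned} \mu_k&:=\Bigl[\eta_k+(\eta_k+1)/\sqrt{1+\sigma_k^2\kappa_g^2}\Bigr]/(1-\eta_k)\to 1/\sqrt{1+\sigma_\infty^2\kappa_g^2},\\ \mu_k'&:=1/[(1-\eta_k)\sigma_k]\to1/\sigma_\infty,\\ \mu_k''&:=\|y^{k+1}\|/[(1-\eta_k)\sigma_k]\to\|y^\infty\|/\sigma_\infty,\\ \mu_k'''&:=\bigl[\eta_k^2\|y^{k+1}-y^k\|+\|y^{k+1}\|+\|y^k\|\bigr]/[2(1-\eta_k)\sigma_k]\to\|y^\infty\|/\sigma_\infty . \end{aligned}$$ All four limits are $0$ if $\sigma_\infty=+\infty$. Consequently, if $\sigma_\infty=+\infty$, then $\operatorname{dist}(y^{k+1},\mathrm{SOL}_D)$,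 $\|\Pi_{\mathcal Q^\circ}(\mathcal Bx^{k+1}-b)\|$ and $|\langle y^{k+1},\mathcal Bx^{k+1}-b\rangle|$ are $o(\operatorname{dist}(y^k,\mathrm{SOL}_D))$, and for every $\delta>0$, $f^0(x^{k+1})-\inf(\mathrm P)\le\delta\operatorname{dist}(y^k,\mathrm{SOL}_D)$ for all sufficiently large $k$. -/

import Mathlib

open Set Filter Topology Asymptotics

noncomputable section

section Convex

variable {E : Type*} [NormedAddCommGroup E] [InnerProductSpace ℝ E]

/-- The effective domain of an extended-real-valued function. -/
def effDom (f : E → EReal) : Set E := {x | f x < ⊤}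

/-- A proper closed convex function `f : E → (-∞, +∞]`: it never takes the value `-∞`, it is not
identically `+∞`, it is lower semicontinuous, and its epigraph is convex. -/
structure ProperClosedConvex (f : E → EReal) : Prop where
  ne_bot : ∀ x, f x ≠ ⊥
  nonempty : (effDom f).Nonempty
  lsc : LowerSemicontinuous f
  convex : Convex ℝ {q : E × ℝ | f q.1 ≤ (q.2 : EReal)}

/-- The (convex) subdifferential of `f` at `x`. -/
def subdiff (f : E → EReal) (x : E) : Set E :=
  {v | ∀ z, f x + ((inner ℝ v (z - x) : ℝ) : EReal) ≤ f z}

/-- The normal cone, in the sense of convex analysis, of a set `D` at `x`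
(empty if `x` is not in `D`). -/
def normalCone (D : Set E) (x : E) : Set E :=
  {v | x ∈ D ∧ ∀ d ∈ D, inner ℝ v (d - x) ≤ 0}

/-- The polar cone `{y | ⟨y, d⟩ ≤ 0 for all d ∈ D}`. -/
def polarCone (D : Set E) : Set E := {y | ∀ d ∈ D, inner ℝ y d ≤ 0}

/-- The Euclidean projection of `z` onto `D`: a point of `D` at the least distance from `z`.
(If `D` is nonempty, closed and convex, there is exactly one, see `proj_spec`, `proj_unique`.) -/
def proj (D : Set E) (z : E) : E :=
  Classical.epsilon fun v => v ∈ D ∧ ∀ w ∈ D, ‖z - v‖ ≤ ‖z - w‖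

theorem proj_spec [FiniteDimensional ℝ E] {D : Set E} (hc : IsClosed D) (hne : D.Nonempty)
    (z : E) : proj D z ∈ D ∧ ∀ w ∈ D, ‖z - proj D z‖ ≤ ‖z - w‖ := by
  have h : ∃ v, v ∈ D ∧ ∀ w ∈ D, ‖z - v‖ ≤ ‖z - w‖ := by
    obtain ⟨v, hv, hd⟩ := hc.exists_infDist_eq_dist hne z
    refine ⟨v, hv, fun w hw => ?_⟩
    rw [← dist_eq_norm, ← dist_eq_norm, ← hd]
    exact Metric.infDist_le_dist_of_mem hw
  exact Classical.epsilon_spec (p := fun v => v ∈ D ∧ ∀ w ∈ D, ‖z - v‖ ≤ ‖z - w‖) h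

theorem proj_unique [FiniteDimensional ℝ E] {D : Set E} (hc : IsClosed D) (hD : Convex ℝ D)
    {z v : E} (hv : v ∈ D) (hmin : ∀ w ∈ D, ‖z - v‖ ≤ ‖z - w‖) : proj D z = v := by
  obtain ⟨hp, hpm⟩ := proj_spec hc ⟨v, hv⟩ z
  have hm := hD hp hv (by norm_num : (0 : ℝ) ≤ 1 / 2) (by norm_num : (0 : ℝ) ≤ 1 / 2) (by norm_num)
  have h1 := hmin _ hm
  have h2 := hpm v hv
  have h3 := hmin _ hp
  have h4 : z - ((1 / 2 : ℝ) • proj D z + (1 / 2 : ℝ) • v)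
      = (1 / 2 : ℝ) • ((z - proj D z) + (z - v)) := by module
  have h5 := parallelogram_law_with_norm ℝ (z - proj D z) (z - v)
  have h6 : ‖z - ((1 / 2 : ℝ) • proj D z + (1 / 2 : ℝ) • v)‖
      = 1 / 2 * ‖(z - proj D z) + (z - v)‖ := by
    rw [h4, norm_smul]; norm_num
  have h7 : (z - proj D z) - (z - v) = v - proj D z := by abel
  rw [h7] at h5
  have h8 : ‖v - proj D z‖ * ‖v - proj D z‖ ≤ 0 := by
    have := norm_nonneg (z - v)
    have : ‖z - proj D z‖ = ‖z - v‖ := le_antisymm h2 h3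
    rw [this] at h5
    nlinarith
  have h9 : ‖v - proj D z‖ = 0 := by nlinarith [norm_nonneg (v - proj D z)]
  exact (sub_eq_zero.mp (norm_eq_zero.mp h9)).symm

/-- An essentially smooth function: the interior of its effective domain is nonempty, the function
is differentiable there, and the norm of its gradient tends to `+∞` along every approach, from this
interior, of a boundary point of it. -/
structure EssentiallySmooth [FiniteDimensional ℝ E] (f : E → EReal) : Prop where
  nonempty : (interior (effDom f)).Nonempty
  differentiable : ∀ x ∈ interior (effDom f), DifferentiableAt ℝ (fun z => (f z).toReal) x
  steep : ∀ x ∈ frontier (interior (effDom f)),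
    Tendsto (fun z => ‖gradient (fun z => (f z).toReal) z‖) (𝓝[interior (effDom f)] x) atTop

end Convex

/-- The data of a convex composite conic program
`min h(Ax) + ⟨c, x⟩ + p(x)` subject to `Bx ∈ b + Q`. -/
structure CCCP (X Y W : Type*)
    [NormedAddCommGroup X] [InnerProductSpace ℝ X] [FiniteDimensional ℝ X]
    [NormedAddCommGroup Y] [InnerProductSpace ℝ Y] [FiniteDimensional ℝ Y]
    [NormedAddCommGroup W] [InnerProductSpace ℝ W] [FiniteDimensional ℝ W] where
  A : X →ₗ[ℝ] W
  B : X →ₗ[ℝ] Y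
  /-- the closed convex cone (it contains `0`) -/
  Q : ProperCone ℝ Y
  c : X
  b : Y
  p : X → EReal
  h : W → EReal
  p_pcc : ProperClosedConvex p
  h_pcc : ProperClosedConvex h
  h_smooth : EssentiallySmooth h
  h_lip : LocallyLipschitzOn (interior (effDom h)) (gradient fun w => (h w).toReal)

namespace CCCP

variable {X Y W : Type*}
  [NormedAddCommGroup X] [InnerProductSpace ℝ X] [FiniteDimensional ℝ X]
  [NormedAddCommGroup Y] [InnerProductSpace ℝ Y] [FiniteDimensional ℝ Y]
  [NormedAddCommGroup W] [InnerProductSpace ℝ W] [FiniteDimensional ℝ W]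
  (P : CCCP X Y W)

/-- The primal objective `f⁰(x) = h(Ax) + ⟨c, x⟩ + p(x)`. -/
def f0 (x : X) : EReal := P.h (P.A x) + ((inner ℝ P.c x : ℝ) : EReal) + P.p x

/-- The polar cone `Q°`. -/
def Qpolar : Set Y := polarCone (P.Q : Set Y)

/-- The primal optimal value `inf (P)`. -/
def infP : EReal := ⨅ x ∈ {x : X | P.B x - P.b ∈ P.Q}, P.f0 x

open Classical in
/-- The extended Lagrangian. -/
def lagrangian (x : X) (y : Y) : EReal :=
  if x ∈ effDom P.f0 then
    if y ∈ P.Qpolar then P.f0 x + ((inner ℝ y (P.B x - P.b) : ℝ) : EReal) else ⊥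
  else ⊤

/-- The dual objective `g⁰(y) = inf_x l(x, y)`. -/
def g0 (y : Y) : EReal := ⨅ x, P.lagrangian x y

/-- The dual optimal value `sup (D)`, the supremum of `g⁰` over `Q°`. -/
def supD : EReal := ⨆ y ∈ P.Qpolar, P.g0 y

/-- The set of optimal solutions of the dual problem. -/
def solD : Set Y := {y | y ∈ P.Qpolar ∧ ∀ z ∈ P.Qpolar, P.g0 z ≤ P.g0 y}

/-- The set of dual feasible solutions, `dom (-g⁰) ∩ Q°`. -/
def feasD : Set Y := {y | -P.g0 y < ⊤ ∧ y ∈ P.Qpolar}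

/-- The Karush-Kuhn-Tucker system
`0 ∈ A* ∇h(Ax) + c + ∂p(x) + B* y`, `y ∈ N_Q(Bx - b)`, where `∇h(Ax)` presupposes that `Ax` is an
interior point of the domain of `h`. -/
def IsKKT (x : X) (y : Y) : Prop :=
  P.A x ∈ interior (effDom P.h) ∧
  -(P.A.adjoint (gradient (fun w => (P.h w).toReal) (P.A x)) + P.c + P.B.adjoint y)
    ∈ subdiff P.p x ∧
  y ∈ normalCone (P.Q : Set Y) (P.B x - P.b)

/-- The quadratic growth condition for the dual problem at `ybar`, with modulus `κ`. -/
def DualQuadGrowth (ybar : Y) (κ : ℝ) : Prop :=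
  0 < κ ∧ ∃ ε : ℝ, 0 < ε ∧ ∀ y ∈ P.feasD ∩ Metric.closedBall ybar ε,
    -P.supD + ((κ * Metric.infDist y P.solD ^ 2 : ℝ) : EReal) ≤ -P.g0 y

/-- The augmented Lagrangian `L_σ(x, y)`. -/
def augLag (σ : ℝ) (x : X) (y : Y) : EReal :=
  P.f0 x + ((1 / (2 * σ) *
    (‖proj P.Qpolar (y + σ • (P.B x - P.b))‖ ^ 2 - ‖y‖ ^ 2) : ℝ) : EReal)

/-- The multipliers of an augmented Lagrangian method: `y⁰ ∈ Q°` and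
`yᵏ⁺¹ = Π_{Q°}[yᵏ + σₖ (B xᵏ⁺¹ - b)]`. (How `xᵏ⁺¹` approximately minimizes `L_{σₖ}(·, yᵏ)` is
the subject of the criteria `CritA`, `CritB`.) -/
def IsALM (σ : ℕ → ℝ) (x : ℕ → X) (y : ℕ → Y) : Prop :=
  y 0 ∈ P.Qpolar ∧
  ∀ k, y (k + 1) = proj P.Qpolar (y k + σ k • (P.B (x (k + 1)) - P.b))

/-- Criterion (A'): with `fₖ = L_{σₖ}(·, yᵏ)`, `fₖ(xᵏ⁺¹) - inf fₖ ≤ εₖ² / (2σₖ)`, `εₖ ≥ 0`,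
`∑ εₖ < ∞`. -/
def CritA (σ : ℕ → ℝ) (x : ℕ → X) (y : ℕ → Y) (ε : ℕ → ℝ) : Prop :=
  (∀ k, 0 ≤ ε k) ∧ Summable ε ∧
  ∀ k, P.augLag (σ k) (x (k + 1)) (y k) ≤
    (⨅ z, P.augLag (σ k) z (y k)) + ((ε k ^ 2 / (2 * σ k) : ℝ) : EReal)

/-- Criterion (B'): with `fₖ = L_{σₖ}(·, yᵏ)`,
`fₖ(xᵏ⁺¹) - inf fₖ ≤ (ηₖ² / (2σₖ)) ‖yᵏ⁺¹ - yᵏ‖²`, `0 ≤ ηₖ < 1`, `∑ ηₖ < ∞`. -/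
def CritB (σ : ℕ → ℝ) (x : ℕ → X) (y : ℕ → Y) (η : ℕ → ℝ) : Prop :=
  (∀ k, 0 ≤ η k ∧ η k < 1) ∧ Summable η ∧
  ∀ k, P.augLag (σ k) (x (k + 1)) (y k) ≤
    (⨅ z, P.augLag (σ k) z (y k)) +
      ((η k ^ 2 / (2 * σ k) * ‖y (k + 1) - y k‖ ^ 2 : ℝ) : EReal)

end CCCP

/-- The rate `μ = [η + (η + 1)/√(1 + σ²κ²)] / (1 - η)` for the dual distance. -/
def rateDual (η σ κ : ℝ) : ℝ := (η + (η + 1) / √(1 + σ ^ 2 * κ ^ 2)) / (1 - η)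

/-- The coefficient `μ' = 1/[(1 - η)σ]` for the primal infeasibility. -/
def rateFeas (η σ : ℝ) : ℝ := 1 / ((1 - η) * σ)

/-- The coefficient `μ'' = ‖y⁺‖/[(1 - η)σ]` for the complementarity. -/
def rateCompl {Y : Type*} [NormedAddCommGroup Y] (η σ : ℝ) (yplus : Y) : ℝ :=
  ‖yplus‖ / ((1 - η) * σ)

/-- The coefficient `μ''' = [η²‖y⁺ - y‖ + ‖y⁺‖ + ‖y‖]/[2(1 - η)σ]` for the objective gap. -/
def rateGap {Y : Type*} [NormedAddCommGroup Y] (η σ : ℝ) (y yplus : Y) : ℝ :=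
  (η ^ 2 * ‖yplus - y‖ + ‖yplus‖ + ‖y‖) / (2 * (1 - η) * σ)

end

/-!
The method is an inexact proximal point algorithm for the dual problem, and the proof works with
this description only. Let `y⁺ = Π_{Q°}[y + σ(Bx - b)]`.

*The proximal point.* `L_σ(x, y)` is the maximum over `w ∈ Q°` of the concave quadratic function
`f⁰(x) + ⟨w, Bx - b⟩ - ‖w - y‖²/(2σ)`, attained at `y⁺`. With the strong concavity in `w`, every
`x` and every `w ∈ Q°` satisfy
`L_σ(x, y) ≥ g⁰(w) - ‖w - y‖²/(2σ) + ‖w - y⁺‖²/(2σ)` (`CCCP.quadratic_le_realAugLag`). Therefore the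
updates `y⁺` along a minimizing sequence of `L_σ(·, y)` are bounded. Comparing `L_σ` at the members
of that sequence with its values on segments towards an arbitrary `x`
(`CCCP.realAugLag_segment_le`) shows that a cluster point `z` satisfies
`g⁰(z) - ‖z - y‖²/(2σ) ≥ inf L_σ(·, y)`. So the minimum over `x` and the maximum over `w` may be
exchanged, `z` is the proximal point of `y`, and an `x` with gap at most `δ²/(2σ)` has
`‖y⁺ - z‖ ≤ δ` (`CCCP.exists_isProxPoint`). No conjugate duality is used, and the infimum over `x`
need not be attained.

*Convergence.* Dual solutions exist by the gradient inequality at a Karush-Kuhn-Tucker pair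
(`CCCP.IsKKT.dual_optimal`). The distances of `yᵏ` to each of them converge, since the proximal map
does not increase them and the errors are summable; the steps `zᵏ - yᵏ` tend to `0`, hence
`g⁰(zᵏ)` tends to the optimal value, and cluster points are solutions because `g⁰` is upper
semicontinuous on `Q°` (`CCCP.exists_tendsto_of_isProxPoint`).

*Rates.* Quadratic growth makes the exact proximal step a contraction of the distance to the
solutions with factor `1/√(1 + σ²κ²)` (`CCCP.IsProxPoint.infDist_le`). The relative error criterion
transfers this to `y⁺`, with `‖y⁺ - y‖ ≤ dist(y)/(1 - η)` (`CCCP.step_le`). The Moreau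
decomposition `Bx - b = d + (y⁺ - y)/σ` with `d ∈ Q`, `⟨y⁺, d⟩ = 0`, and `inf L_σ(·, y) ≤ inf (P)`,
bound the primal residuals by the step `‖y⁺ - y‖`.
-/

noncomputable section

/-! ### Projection onto a polar cone, and convex functions with values in `EReal` -/

section ConvexAnalysis

variable {E : Type*} [NormedAddCommGroup E] [InnerProductSpace ℝ E]

theorem isClosed_polarCone (D : Set E) : IsClosed (polarCone D) := by
  have : polarCone D = ⋂ d ∈ D, {y : E | inner ℝ y d ≤ 0} := by
    ext y; simp [polarCone]
  rw [this]
  exact isClosed_biInter fun d _ =>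
    isClosed_le (continuous_id.inner continuous_const) continuous_const

theorem convex_polarCone (D : Set E) : Convex ℝ (polarCone D) := by
  intro u hu v hv s t hs ht _ d hd
  rw [inner_add_left, real_inner_smul_left, real_inner_smul_left]
  nlinarith [mul_nonpos_of_nonneg_of_nonpos hs (hu d hd),
    mul_nonpos_of_nonneg_of_nonpos ht (hv d hd)]

theorem zero_mem_polarCone (D : Set E) : (0 : E) ∈ polarCone D := fun d _ => by simp

theorem smul_mem_polarCone {D : Set E} {y : E} (hy : y ∈ polarCone D) {s : ℝ} (hs : 0 ≤ s) :
    s • y ∈ polarCone D := fun d hd => by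
  rw [real_inner_smul_left]
  exact mul_nonpos_of_nonneg_of_nonpos hs (hy d hd)

/-- The bipolar theorem for a closed convex cone, in the direction that is not trivial. -/
theorem mem_of_forall_polarCone [FiniteDimensional ℝ E] (Q : ProperCone ℝ E) {w : E}
    (h : ∀ y ∈ polarCone (Q : Set E), inner ℝ w y ≤ 0) : w ∈ Q := by
  by_contra hw
  obtain ⟨v, hv, hlt⟩ := Q.hyperplane_separation' hw
  have := h (-v) fun d hd => by
    rw [inner_neg_left, real_inner_comm]; linarith [hv d hd]
  rw [inner_neg_right] at this
  linarith

/-- Moreau's decomposition of `w` along `Q°` and `Q`. -/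
theorem moreau_decomposition [FiniteDimensional ℝ E] (Q : ProperCone ℝ E) (w : E) :
    proj (polarCone (Q : Set E)) w ∈ polarCone (Q : Set E) ∧
    w - proj (polarCone (Q : Set E)) w ∈ Q ∧
    inner ℝ (proj (polarCone (Q : Set E)) w) (w - proj (polarCone (Q : Set E)) w) = 0 := by
  set K := polarCone (Q : Set E) with hK
  obtain ⟨hp, hmin⟩ := proj_spec (isClosed_polarCone (Q : Set E)) ⟨0, zero_mem_polarCone _⟩ w
  rw [← hK] at hp hmin
  set p := proj K w with hpdef
  have : Nonempty K := ⟨⟨p, hp⟩⟩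
  have hinf : ‖w - p‖ = ⨅ v : K, ‖w - v‖ :=
    le_antisymm (le_ciInf fun v => hmin v v.2)
      (ciInf_le (f := fun v : K => ‖w - v‖) ⟨0, by rintro _ ⟨v, rfl⟩; exact norm_nonneg _⟩ ⟨p, hp⟩)
  have hvar := (norm_eq_iInf_iff_real_inner_le_zero (convex_polarCone (Q : Set E)) hp).1 hinf
  have h0 := hvar 0 (zero_mem_polarCone _)
  have h2 := hvar ((2 : ℝ) • p) (smul_mem_polarCone hp (by norm_num))
  rw [zero_sub, inner_neg_right] at h0
  rw [two_smul, add_sub_cancel_right] at h2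
  have horth : inner ℝ (w - p) p = 0 := by linarith
  refine ⟨hp, mem_of_forall_polarCone Q fun v hv => ?_, by rw [real_inner_comm]; exact horth⟩
  have := hvar v hv
  rw [inner_sub_right] at this
  linarith

/-- The norm of the projection onto `Q°` is the distance to `Q`; this is the half that bounds it. -/
theorem norm_proj_polarCone_le [FiniteDimensional ℝ E] (Q : ProperCone ℝ E) (w : E) {d : E}
    (hd : d ∈ Q) : ‖proj (polarCone (Q : Set E)) w‖ ≤ ‖w - d‖ := by
  obtain ⟨hp, -, horth⟩ := moreau_decomposition Q w
  set p := proj (polarCone (Q : Set E)) w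
  have h1 := hp d hd
  have h2 := real_inner_le_norm p (w - d)
  rw [inner_sub_right] at h2 horth
  rw [real_inner_self_eq_norm_sq] at horth
  by_contra! hlt
  nlinarith [norm_nonneg (w - d)]

theorem convexOn_toReal_of_properClosedConvex {f : E → EReal} (hf : ProperClosedConvex f) :
    ConvexOn ℝ (effDom f) fun x => (f x).toReal := by
  have key : ∀ ⦃x⦄, x ∈ effDom f → ∀ ⦃y⦄, y ∈ effDom f → ∀ ⦃a b : ℝ⦄, 0 ≤ a → 0 ≤ b →
      a + b = 1 → f (a • x + b • y) ≤ ((a • (f x).toReal + b • (f y).toReal : ℝ) : EReal) := by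
    intro x hx y hy a b ha hb hab
    have hcx : (x, (f x).toReal) ∈ {q : E × ℝ | f q.1 ≤ (q.2 : EReal)} :=
      (EReal.coe_toReal (ne_of_lt hx) (hf.ne_bot x)).ge
    have hcy : (y, (f y).toReal) ∈ {q : E × ℝ | f q.1 ≤ (q.2 : EReal)} :=
      (EReal.coe_toReal (ne_of_lt hy) (hf.ne_bot y)).ge
    exact hf.convex hcx hcy ha hb hab
  refine ⟨fun x hx y hy a b ha hb hab =>
    (key hx hy ha hb hab).trans_lt (EReal.coe_lt_top _), fun x hx y hy a b ha hb hab => ?_⟩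
  have h := key hx hy ha hb hab
  have hlt : f (a • x + b • y) < ⊤ := h.trans_lt (EReal.coe_lt_top _)
  rw [← EReal.coe_toReal hlt.ne (hf.ne_bot _)] at h
  exact EReal.coe_le_coe_iff.1 h

/-- The gradient inequality for a convex function on a convex set. -/
theorem gradient_inequality [CompleteSpace E] {s : Set E} {f : E → ℝ} (hf : ConvexOn ℝ s f)
    {x z : E} (hx : x ∈ s) (hz : z ∈ s) (hd : DifferentiableAt ℝ f x) :
    f x + inner ℝ (gradient f x) (z - x) ≤ f z := by
  have hlim := hd.hasGradientAt.hasFDerivAt.lim_real (z - x)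
  have hle : inner ℝ (gradient f x) (z - x) ≤ f z - f x := by
    refine le_of_tendsto hlim ?_
    filter_upwards [eventually_ge_atTop (1 : ℝ)] with c hc
    have hc0 : 0 < c := by linarith
    have hcinv : c⁻¹ ≤ 1 := inv_le_one_of_one_le₀ hc
    have h := hf.2 hx hz (sub_nonneg.2 hcinv) (inv_nonneg.2 hc0.le) (by ring)
    have hpt : (1 - c⁻¹) • x + c⁻¹ • z = x + c⁻¹ • (z - x) := by module
    rw [hpt] at h
    simp only [smul_eq_mul] at h ⊢
    calc c * (f (x + c⁻¹ • (z - x)) - f x)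
        ≤ c * (((1 - c⁻¹) * f x + c⁻¹ * f z) - f x) := by gcongr
      _ = f z - f x := by field_simp; ring
  linarith

end ConvexAnalysis

namespace CCCP

variable {X Y W : Type*}
  [NormedAddCommGroup X] [InnerProductSpace ℝ X] [FiniteDimensional ℝ X]
  [NormedAddCommGroup Y] [InnerProductSpace ℝ Y] [FiniteDimensional ℝ Y]
  [NormedAddCommGroup W] [InnerProductSpace ℝ W] [FiniteDimensional ℝ W]
  (P : CCCP X Y W)

/-! ### The objective, the dual function and the augmented Lagrangian in real terms -/

/-- The primal objective as a real number, meaningful on `effDom P.f0`. -/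
def F (x : X) : ℝ := (P.f0 x).toReal

/-- The constraint map `x ↦ Bx - b`. -/
def q (x : X) : Y := P.B x - P.b

/-- The multiplier update `Π_{Q°}[y + σ (Bx - b)]`. -/
def update (σ : ℝ) (x : X) (y : Y) : Y := proj P.Qpolar (y + σ • P.q x)

/-- The augmented Lagrangian as a real number, meaningful for `x ∈ effDom P.f0`. -/
def realAugLag (σ : ℝ) (x : X) (y : Y) : ℝ :=
  P.F x + 1 / (2 * σ) * (‖P.update σ x y‖ ^ 2 - ‖y‖ ^ 2)

variable {P}

theorem f0_ne_bot (x : X) : P.f0 x ≠ ⊥ := by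
  simp [f0, EReal.add_eq_bot_iff, P.h_pcc.ne_bot, P.p_pcc.ne_bot]

theorem mem_effDom_f0 {x : X} : x ∈ effDom P.f0 ↔ P.A x ∈ effDom P.h ∧ x ∈ effDom P.p := by
  simp only [effDom, mem_ofPred_eq]
  constructor
  · intro hx
    constructor
    · by_contra! htop
      rw [top_le_iff] at htop
      simp [f0, htop, P.p_pcc.ne_bot] at hx
    · by_contra! htop
      rw [top_le_iff] at htop
      have : P.h (P.A x) + ((inner ℝ P.c x : ℝ) : EReal) ≠ ⊥ := by
        simp [EReal.add_eq_bot_iff, P.h_pcc.ne_bot]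
      simp [f0, htop, this] at hx
  · rintro ⟨hh, hp⟩
    exact EReal.add_lt_top (EReal.add_lt_top hh.ne (EReal.coe_ne_top _)).ne hp.ne

theorem f0_eq {x : X} (hx : x ∈ effDom P.f0) : P.f0 x = (P.F x : EReal) :=
  (EReal.coe_toReal (ne_of_lt hx) (f0_ne_bot x)).symm

theorem F_eq {x : X} (hx : x ∈ effDom P.f0) :
    P.F x = (P.h (P.A x)).toReal + inner ℝ P.c x + (P.p x).toReal := by
  obtain ⟨hh, hp⟩ := mem_effDom_f0.1 hx
  have h1 := EReal.coe_toReal (ne_of_lt hh) (P.h_pcc.ne_bot _)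
  have h2 := EReal.coe_toReal (ne_of_lt hp) (P.p_pcc.ne_bot _)
  have h3 : P.f0 x =
      (((P.h (P.A x)).toReal + inner ℝ P.c x + (P.p x).toReal : ℝ) : EReal) := by
    rw [EReal.coe_add, EReal.coe_add, h1, h2, f0]
  rw [F, h3, EReal.toReal_coe]

theorem convexOn_F : ConvexOn ℝ (effDom P.f0) P.F := by
  have hh := convexOn_toReal_of_properClosedConvex P.h_pcc
  have hp := convexOn_toReal_of_properClosedConvex P.p_pcc
  have hdom : Convex ℝ (effDom P.f0) := by
    intro u hu v hv a b ha hb hab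
    rw [mem_effDom_f0] at hu hv ⊢
    refine ⟨?_, hp.1 hu.2 hv.2 ha hb hab⟩
    rw [map_add, map_smul, map_smul]
    exact hh.1 hu.1 hv.1 ha hb hab
  refine ⟨hdom, fun u hu v hv a b ha hb hab => ?_⟩
  rw [F_eq (hdom hu hv ha hb hab), F_eq hu, F_eq hv]
  rw [mem_effDom_f0] at hu hv
  have h1 := hh.2 hu.1 hv.1 ha hb hab
  have h2 := hp.2 hu.2 hv.2 ha hb hab
  simp only [smul_eq_mul] at h1 h2 ⊢
  rw [map_add, map_smul, map_smul, inner_add_right, real_inner_smul_right, real_inner_smul_right]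
  linarith

theorem q_affine (u v : X) {a b : ℝ} (hab : a + b = 1) :
    P.q (a • u + b • v) = a • P.q u + b • P.q v := by
  have hb : P.b = a • P.b + b • P.b := by rw [← add_smul, hab, one_smul]
  simp only [q, map_add, map_smul, smul_sub]
  nth_rw 1 [hb]
  abel

theorem coe_le_g0_iff {y : Y} (hy : y ∈ P.Qpolar) {m : ℝ} :
    (m : EReal) ≤ P.g0 y ↔ ∀ x ∈ effDom P.f0, m ≤ P.F x + inner ℝ y (P.q x) := by
  rw [g0, le_iInf_iff]
  refine forall_congr' fun x => ?_
  by_cases hx : x ∈ effDom P.f0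
  · rw [lagrangian, if_pos hx, if_pos hy, f0_eq hx, ← EReal.coe_add, EReal.coe_le_coe_iff]
    simp [hx, q]
  · simp [lagrangian, hx]

theorem g0_le {y : Y} (hy : y ∈ P.Qpolar) {x : X} (hx : x ∈ effDom P.f0) :
    P.g0 y ≤ ((P.F x + inner ℝ y (P.q x) : ℝ) : EReal) := by
  refine (iInf_le _ x).trans ?_
  rw [lagrangian, if_pos hx, if_pos hy, f0_eq hx, ← EReal.coe_add]
  rfl

theorem augLag_eq {x : X} (hx : x ∈ effDom P.f0) (σ : ℝ) (y : Y) :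
    P.augLag σ x y = (P.realAugLag σ x y : EReal) := by
  rw [augLag, f0_eq hx, ← EReal.coe_add]
  rfl

theorem augLag_eq_top {x : X} (hx : x ∉ effDom P.f0) (σ : ℝ) (y : Y) : P.augLag σ x y = ⊤ := by
  have : P.f0 x = ⊤ := by simpa [effDom] using hx
  rw [augLag, this, EReal.top_add_coe]

theorem isClosed_Qpolar : IsClosed P.Qpolar := isClosed_polarCone _

/-- The Moreau decomposition behind the multiplier update: the residual `σ(Bx - b) - (y⁺ - y)` is
an element of `Q`, orthogonal to `y⁺`. -/
theorem update_spec (σ : ℝ) (x : X) (y : Y) :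
    P.update σ x y ∈ P.Qpolar ∧ y + σ • P.q x - P.update σ x y ∈ P.Q ∧
    inner ℝ (P.update σ x y) (y + σ • P.q x - P.update σ x y) = 0 :=
  moreau_decomposition P.Q _

/-! ### Optimality of the multiplier of a Karush-Kuhn-Tucker pair -/

/-- The multiplier of a KKT pair is dual optimal, with a finite dual value. -/
theorem IsKKT.dual_optimal {xbar : X} {ybar : Y} (h : P.IsKKT xbar ybar) :
    ybar ∈ P.solD ∧ xbar ∈ effDom P.f0 ∧ P.g0 ybar = (P.F xbar : EReal) := by
  obtain ⟨hA, hsub, hq, hN⟩ := h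
  -- `∂p(x̄)` is nonempty only where the proper function `p` is finite.
  have hpfin : xbar ∈ effDom P.p := by
    by_contra htop
    have htop' : P.p xbar = ⊤ := by simpa [effDom] using htop
    obtain ⟨z, hz⟩ := P.p_pcc.nonempty
    have := hsub z
    rw [htop', EReal.top_add_coe, top_le_iff] at this
    exact (ne_of_lt hz) this
  have hdom : xbar ∈ effDom P.f0 := mem_effDom_f0.2 ⟨interior_subset hA, hpfin⟩
  have horth : inner ℝ ybar (P.q xbar) = 0 := by
    have h0 := hN 0 P.Q.zero_mem
    have h2 := hN ((2 : ℝ) • (P.B xbar - P.b)) (P.Q.smul_mem hq (by norm_num))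
    rw [zero_sub, inner_neg_right] at h0
    rw [two_smul, add_sub_cancel_right] at h2
    exact le_antisymm h2 (by simpa [q] using h0)
  have hpol : ybar ∈ P.Qpolar := fun d hd => by
    have := hN d hd
    rw [inner_sub_right] at this
    have h' : inner ℝ ybar (P.B xbar - P.b) = 0 := horth
    linarith
  have hle : (P.F xbar : EReal) ≤ P.g0 ybar := by
    refine (coe_le_g0_iff hpol).2 fun x hx => ?_
    obtain ⟨hh, hp⟩ := mem_effDom_f0.1 hx
    have h1 := gradient_inequality (convexOn_toReal_of_properClosedConvex P.h_pcc)
      (interior_subset hA) hh (P.h_smooth.differentiable _ hA)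
    have h2 := hsub x
    rw [← EReal.coe_toReal (ne_of_lt hp) (P.p_pcc.ne_bot _),
      ← EReal.coe_toReal (ne_of_lt hpfin) (P.p_pcc.ne_bot _), ← EReal.coe_add,
      EReal.coe_le_coe_iff, inner_neg_left, inner_add_left, inner_add_left,
      LinearMap.adjoint_inner_left, LinearMap.adjoint_inner_left, map_sub, map_sub,
      inner_sub_right P.c] at h2
    rw [F_eq hx, F_eq hdom]
    have h3 : inner ℝ ybar (P.B x - P.B xbar) = inner ℝ ybar (P.q x) := by
      have : P.B x - P.B xbar = P.q x - P.q xbar := by simp [q]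
      rw [this, inner_sub_right, horth, sub_zero]
    linarith
  refine ⟨⟨hpol, fun z hz => ?_⟩, hdom, le_antisymm ?_ hle⟩
  · refine (g0_le hz hdom).trans (le_trans ?_ hle)
    rw [EReal.coe_le_coe_iff]
    have : inner ℝ z (P.q xbar) ≤ 0 := hz _ hq
    linarith
  · have := g0_le hpol hdom
    rwa [horth, add_zero] at this

/-! ### The augmented Lagrangian and the proximal map of the dual function -/

/-- `z` is the proximal point of `y` for the concave function `g⁰` on `Q°` with parameter `σ`, and
`g⁰ z = γ`. It is encoded by its optimality condition: `(z - y)/σ` is a supergradient of `g⁰` at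
`z`, relative to `Q°`. -/
structure IsProxPoint (P : CCCP X Y W) (σ : ℝ) (y z : Y) (γ : ℝ) : Prop where
  mem : z ∈ P.Qpolar
  g0_eq : P.g0 z = (γ : EReal)
  le : ∀ w ∈ P.Qpolar, P.g0 w ≤ ((γ + inner ℝ (w - z) (z - y) / σ : ℝ) : EReal)

/-- The augmented Lagrangian is the value at `y⁺` of the concave quadratic function
`w ↦ F x + ⟨w, q x⟩ - ‖w - y‖² / (2σ)`, which has its maximum over `Q°` at `y⁺`. -/
theorem quadratic_le_realAugLag {σ : ℝ} (hσ : 0 < σ) (x : X) (y : Y) {w : Y}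
    (hw : w ∈ P.Qpolar) :
    P.F x + inner ℝ w (P.q x) + (‖w - P.update σ x y‖ ^ 2 - ‖w - y‖ ^ 2) / (2 * σ)
      ≤ P.realAugLag σ x y := by
  obtain ⟨-, hQ, -⟩ := update_spec σ x y (P := P)
  rw [realAugLag]
  set u := P.update σ x y
  have h := hw _ hQ
  rw [inner_sub_right, inner_add_right, real_inner_smul_right] at h
  rw [norm_sub_sq_real, norm_sub_sq_real]
  have h2 : inner ℝ w (P.q x) ≤ (inner ℝ w u - inner ℝ w y) / σ := by
    rw [le_div_iff₀ hσ]; linarith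
  have h3 : 1 / (2 * σ) * (‖u‖ ^ 2 - ‖y‖ ^ 2) = (inner ℝ w u - inner ℝ w y) / σ +
      (‖w‖ ^ 2 - 2 * inner ℝ w u + ‖u‖ ^ 2 - (‖w‖ ^ 2 - 2 * inner ℝ w y + ‖y‖ ^ 2)) / (2 * σ) := by
    field_simp; ring
  linarith

/-- An upper bound for the augmented Lagrangian on the segment from `x₀` to `x`. It comes from
writing the augmented Lagrangian as a minimum over slacks `d ∈ Q` and choosing the slack of `x₀`,
scaled by `1 - t`, along the segment: the error term then involves only the update at `x₀`, not
`q x₀`. -/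
theorem realAugLag_segment_le {σ : ℝ} (hσ : 0 < σ) {x₀ x : X} (hx₀ : x₀ ∈ effDom P.f0)
    (hx : x ∈ effDom P.f0) (y : Y) {t : ℝ} (ht0 : 0 ≤ t) (ht1 : t ≤ 1) :
    P.realAugLag σ ((1 - t) • x₀ + t • x) y ≤ P.realAugLag σ x₀ y +
      t * (P.F x - P.F x₀ +
        inner ℝ (P.update σ x₀ y) (y + σ • P.q x - P.update σ x₀ y) / σ) +
      t ^ 2 * (‖y + σ • P.q x - P.update σ x₀ y‖ ^ 2 / (2 * σ)) := by
  have h1t : 0 ≤ 1 - t := sub_nonneg.2 ht1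
  obtain ⟨-, hQ, -⟩ := update_spec σ x₀ y (P := P)
  have hF := convexOn_F.2 hx₀ hx h1t ht0 (by ring)
  simp only [smul_eq_mul] at hF
  have hn := norm_proj_polarCone_le P.Q (y + σ • P.q ((1 - t) • x₀ + t • x))
    (P.Q.smul_mem hQ h1t)
  change ‖P.update σ ((1 - t) • x₀ + t • x) y‖ ≤ _ at hn
  have hpt : y + σ • P.q ((1 - t) • x₀ + t • x) -
      (1 - t) • (y + σ • P.q x₀ - P.update σ x₀ y) =
      P.update σ x₀ y + t • (y + σ • P.q x - P.update σ x₀ y) := by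
    rw [q_affine _ _ (by ring : (1 - t) + t = 1)]
    module
  rw [hpt] at hn
  have hsq := pow_le_pow_left₀ (norm_nonneg _) hn 2
  rw [norm_add_sq_real, real_inner_smul_right, norm_smul, mul_pow, Real.norm_eq_abs, sq_abs] at hsq
  rw [realAugLag, realAugLag]
  generalize ‖P.update σ ((1 - t) • x₀ + t • x) y‖ = a at *
  generalize y + σ • P.q x - P.update σ x₀ y = e at *
  have h4 : 1 / (2 * σ) * (a ^ 2 - ‖y‖ ^ 2) ≤ 1 / (2 * σ) *
      (‖P.update σ x₀ y‖ ^ 2 + 2 * (t * inner ℝ (P.update σ x₀ y) e) + t ^ 2 * ‖e‖ ^ 2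
        - ‖y‖ ^ 2) := by
    gcongr
  have h5 : 1 / (2 * σ) *
      (‖P.update σ x₀ y‖ ^ 2 + 2 * (t * inner ℝ (P.update σ x₀ y) e) + t ^ 2 * ‖e‖ ^ 2
        - ‖y‖ ^ 2) = 1 / (2 * σ) * (‖P.update σ x₀ y‖ ^ 2 - ‖y‖ ^ 2) +
        t * (inner ℝ (P.update σ x₀ y) e / σ) + t ^ 2 * (‖e‖ ^ 2 / (2 * σ)) := by
    field_simp; ring
  linarith

/-- The infimum of the augmented Lagrangian is finite as soon as the dual problem is feasible. -/
theorem exists_iInf_augLag_eq {σ : ℝ} (hσ : 0 < σ) {x₀ : X} (hx₀ : x₀ ∈ effDom P.f0) {w : Y}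
    (hw : w ∈ P.Qpolar) {m : ℝ} (hm : (m : EReal) ≤ P.g0 w) (y : Y) :
    ∃ v : ℝ, (⨅ x, P.augLag σ x y) = (v : EReal) := by
  have hlow : ((m - ‖w - y‖ ^ 2 / (2 * σ) : ℝ) : EReal) ≤ ⨅ x, P.augLag σ x y := by
    refine le_iInf fun x => ?_
    by_cases hx : x ∈ effDom P.f0
    · rw [augLag_eq hx, EReal.coe_le_coe_iff]
      have h1 := quadratic_le_realAugLag hσ x y hw
      have h2 := (coe_le_g0_iff hw).1 hm x hx
      have h3 : 0 ≤ ‖w - P.update σ x y‖ ^ 2 / (2 * σ) := by positivity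
      rw [sub_div] at h1
      linarith
    · rw [augLag_eq_top hx]; exact le_top
  have hup : (⨅ x, P.augLag σ x y) < ⊤ :=
    (iInf_le _ x₀).trans_lt (by rw [augLag_eq hx₀]; exact EReal.coe_lt_top _)
  exact ⟨_, (EReal.coe_toReal hup.ne ((EReal.bot_lt_coe _).trans_le hlow).ne').symm⟩

/-- The proximal point `z` of `y` exists, as a cluster point of the updates along a minimizing
sequence of `L_σ(·, y)`, whether or not the infimum is attained. The update of an approximate
minimizer of `L_σ(·, y)` is an approximate proximal point. -/
theorem exists_isProxPoint {σ : ℝ} (hσ : 0 < σ) {x₀ : X} (hx₀ : x₀ ∈ effDom P.f0) {w₀ : Y}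
    (hw₀ : w₀ ∈ P.Qpolar) {m : ℝ} (hm : (m : EReal) ≤ P.g0 w₀) (y : Y) :
    ∃ z γ, P.IsProxPoint σ y z γ ∧ ∀ x δ, 0 ≤ δ →
      P.augLag σ x y ≤ (⨅ u, P.augLag σ u y) + ((δ ^ 2 / (2 * σ) : ℝ) : EReal) →
      ‖P.update σ x y - z‖ ≤ δ := by
  obtain ⟨v, hv⟩ := exists_iInf_augLag_eq hσ hx₀ hw₀ hm y
  have hvle : ∀ x ∈ effDom P.f0, v ≤ P.realAugLag σ x y := fun x hx => by
    rw [← EReal.coe_le_coe_iff, ← hv, ← augLag_eq hx]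
    exact iInf_le _ x
  have happrox : ∀ δ : ℝ, 0 < δ → ∃ x ∈ effDom P.f0, P.realAugLag σ x y < v + δ := by
    intro δ hδ
    have hlt : (⨅ x, P.augLag σ x y) < ((v + δ : ℝ) : EReal) := by
      rw [hv, EReal.coe_lt_coe_iff]; linarith
    obtain ⟨x, hx⟩ := iInf_lt_iff.1 hlt
    have hdom : x ∈ effDom P.f0 := by
      by_contra hn
      rw [augLag_eq_top hn] at hx
      exact not_top_lt hx
    exact ⟨x, hdom, by rwa [augLag_eq hdom, EReal.coe_lt_coe_iff] at hx⟩
  -- The gap is the square of the step length `1/(n+1)` used below along the segments.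
  have hpos : ∀ n : ℕ, (0 : ℝ) < 1 / ((n : ℝ) + 1) := fun n => Nat.one_div_pos_of_nat
  choose xs hxs hgap using fun n : ℕ => happrox ((1 / ((n : ℝ) + 1)) ^ 2) (pow_pos (hpos n) 2)
  have hone : ∀ n : ℕ, 1 / ((n : ℝ) + 1) ≤ 1 := fun n => by
    rw [div_le_one (by positivity)]; linarith [Nat.cast_nonneg (α := ℝ) n]
  -- An upper bound for `g⁰` from the minimizing sequence: it bounds the updates (for `w = w₀`), and
  -- in the limit it becomes the supergradient inequality at the cluster point.
  have hW : ∀ w ∈ P.Qpolar, ∀ n : ℕ, P.g0 w ≤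
      ((v + (1 / ((n : ℝ) + 1)) ^ 2 +
        (‖w - y‖ ^ 2 - ‖w - P.update σ (xs n) y‖ ^ 2) / (2 * σ) : ℝ) : EReal) := by
    intro w hw n
    refine (g0_le hw (hxs n)).trans (EReal.coe_le_coe_iff.2 ?_)
    have h := quadratic_le_realAugLag hσ (xs n) y hw
    have h' := hgap n
    rw [sub_div] at h ⊢
    linarith
  have hbdd : ∀ n, P.update σ (xs n) y ∈
      Metric.closedBall w₀ (√(2 * σ * (v + 1 - m) + ‖w₀ - y‖ ^ 2)) := by
    intro n
    rw [mem_closedBall_iff_norm']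
    refine Real.le_sqrt_of_sq_le ?_
    have h := EReal.coe_le_coe_iff.1 (hm.trans (hW w₀ hw₀ n))
    have h1 : (1 / ((n : ℝ) + 1)) ^ 2 ≤ 1 := pow_le_one₀ (hpos n).le (hone n)
    rw [sub_div] at h
    have h2 : ‖w₀ - P.update σ (xs n) y‖ ^ 2 / (2 * σ) ≤
        v + 1 - m + ‖w₀ - y‖ ^ 2 / (2 * σ) := by linarith
    rw [div_le_iff₀ (by positivity)] at h2
    have h3 : ‖w₀ - y‖ ^ 2 / (2 * σ) * (2 * σ) = ‖w₀ - y‖ ^ 2 := by field_simp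
    linarith
  obtain ⟨z, -, φ, hφ, hz⟩ := tendsto_subseq_of_bounded Metric.isBounded_closedBall hbdd
  have hzmem : z ∈ P.Qpolar :=
    isClosed_Qpolar.mem_of_tendsto hz (Eventually.of_forall fun n => (update_spec _ _ _).1)
  have hinv : Tendsto (fun n => 1 / ((φ n : ℝ) + 1)) atTop (𝓝 0) :=
    tendsto_one_div_add_atTop_nhds_zero_nat.comp hφ.tendsto_atTop
  have hprimal : ∀ x ∈ effDom P.f0, v + ‖z - y‖ ^ 2 / (2 * σ) ≤ P.F x + inner ℝ z (P.q x) := by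
    intro x hx
    have hstep : ∀ n : ℕ, v ≤ P.F x + inner ℝ (P.update σ (xs n) y) (P.q x)
        - ‖P.update σ (xs n) y - y‖ ^ 2 / (2 * σ) + 1 / ((n : ℝ) + 1) +
        1 / ((n : ℝ) + 1) * (‖y + σ • P.q x - P.update σ (xs n) y‖ ^ 2 / (2 * σ)) := by
      intro n
      set t := 1 / ((n : ℝ) + 1)
      set u := P.update σ (xs n) y with hu
      have h1 := realAugLag_segment_le hσ (hxs n) hx y (hpos n).le (hone n)
      have h2 := hvle _ (convexOn_F.1 (hxs n) hx (sub_nonneg.2 (hone n)) (hpos n).le (by ring))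
      have h3 := hvle _ (hxs n)
      have h4 := hgap n
      have ht : 0 < t := hpos n
      rw [← hu] at h1
      have h5 : 0 ≤ t + (P.F x - P.F (xs n) + inner ℝ u (y + σ • P.q x - u) / σ) +
          t * (‖y + σ • P.q x - u‖ ^ 2 / (2 * σ)) := by
        refine nonneg_of_mul_nonneg_right (a := t) ?_ ht
        linarith
      rw [realAugLag, ← hu] at h3
      have h6 : inner ℝ u (y + σ • P.q x - u) / σ + 1 / (2 * σ) * (‖u‖ ^ 2 - ‖y‖ ^ 2) =
          inner ℝ u (P.q x) - ‖u - y‖ ^ 2 / (2 * σ) := by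
        rw [norm_sub_sq_real, inner_sub_right, inner_add_right, real_inner_smul_right,
          real_inner_self_eq_norm_sq]
        field_simp; ring
      linarith
    have hlim : Tendsto (fun n => P.F x + inner ℝ (P.update σ (xs (φ n)) y) (P.q x)
        - ‖P.update σ (xs (φ n)) y - y‖ ^ 2 / (2 * σ) + 1 / ((φ n : ℝ) + 1) +
        1 / ((φ n : ℝ) + 1) * (‖y + σ • P.q x - P.update σ (xs (φ n)) y‖ ^ 2 / (2 * σ))) atTop
        (𝓝 (P.F x + inner ℝ z (P.q x) - ‖z - y‖ ^ 2 / (2 * σ) + 0 +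
          0 * (‖y + σ • P.q x - z‖ ^ 2 / (2 * σ)))) :=
      (((tendsto_const_nhds.add (hz.inner tendsto_const_nhds)).sub
        (((hz.sub_const y).norm.pow 2).div_const _)).add hinv).add
        (hinv.mul (((hz.const_sub _).norm.pow 2).div_const _))
    have := ge_of_tendsto' hlim fun n => hstep (φ n)
    linarith
  have hdual : ∀ w ∈ P.Qpolar, P.g0 w ≤
      ((v + (‖w - y‖ ^ 2 - ‖w - z‖ ^ 2) / (2 * σ) : ℝ) : EReal) := by
    intro w hw
    have hlim : Tendsto (fun n => v + (1 / ((φ n : ℝ) + 1)) ^ 2 +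
        (‖w - y‖ ^ 2 - ‖w - P.update σ (xs (φ n)) y‖ ^ 2) / (2 * σ)) atTop
        (𝓝 (v + 0 ^ 2 + (‖w - y‖ ^ 2 - ‖w - z‖ ^ 2) / (2 * σ))) :=
      (tendsto_const_nhds.add (hinv.pow 2)).add
        ((tendsto_const_nhds.sub ((hz.const_sub w).norm.pow 2)).div_const _)
    rw [zero_pow two_ne_zero, add_zero] at hlim
    exact ge_of_tendsto' ((continuous_coe_real_ereal.tendsto _).comp hlim) fun n => hW w hw (φ n)
  have hg0z : P.g0 z = ((v + ‖z - y‖ ^ 2 / (2 * σ) : ℝ) : EReal) := by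
    refine le_antisymm ?_ ((coe_le_g0_iff hzmem).2 hprimal)
    simpa using hdual z hzmem
  refine ⟨z, _, ⟨hzmem, hg0z, fun w hw => (hdual w hw).trans_eq ?_⟩, fun x δ hδ hle => ?_⟩
  · congr 1
    have h1 : w - y = (w - z) + (z - y) := by abel
    rw [h1, norm_add_sq_real]
    field_simp; ring
  · rw [hv, ← EReal.coe_add] at hle
    have hx : x ∈ effDom P.f0 := by
      by_contra hn
      rw [augLag_eq_top hn] at hle
      exact (EReal.coe_ne_top _) (top_le_iff.1 hle)
    rw [augLag_eq hx, EReal.coe_le_coe_iff] at hle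
    have h1 := quadratic_le_realAugLag hσ x y hzmem
    have h2 := hprimal x hx
    rw [sub_div] at h1
    have h3 : ‖z - P.update σ x y‖ ^ 2 / (2 * σ) ≤ δ ^ 2 / (2 * σ) := by linarith
    rw [div_le_div_iff_of_pos_right (by positivity), norm_sub_rev] at h3
    exact (sq_le_sq₀ (norm_nonneg _) hδ).1 h3

/-! ### Convergence of the multipliers -/

theorem g0_eq_of_mem_solD {s s' : Y} (hs : s ∈ P.solD) (hs' : s' ∈ P.solD) :
    P.g0 s' = P.g0 s :=
  le_antisymm (hs.2 _ hs'.1) (hs'.2 _ hs.1)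

theorem supD_eq {s : Y} (hs : s ∈ P.solD) : P.supD = P.g0 s :=
  le_antisymm (iSup₂_le hs.2) (le_iSup₂ (f := fun y (_ : y ∈ P.Qpolar) => P.g0 y) s hs.1)

/-- The dual function is upper semicontinuous on `Q°`. -/
theorem coe_le_g0_of_tendsto {w : ℕ → Y} {w' : Y} {γ : ℕ → ℝ} {M : ℝ}
    (hw : ∀ n, w n ∈ P.Qpolar) (hγ : ∀ n, (γ n : EReal) ≤ P.g0 (w n))
    (hlim : Tendsto w atTop (𝓝 w')) (hM : Tendsto γ atTop (𝓝 M)) :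
    w' ∈ P.Qpolar ∧ (M : EReal) ≤ P.g0 w' := by
  have hmem : w' ∈ P.Qpolar := isClosed_Qpolar.mem_of_tendsto hlim (Eventually.of_forall hw)
  refine ⟨hmem, (coe_le_g0_iff hmem).2 fun x hx => ?_⟩
  exact le_of_tendsto_of_tendsto' hM (tendsto_const_nhds.add (hlim.inner tendsto_const_nhds))
    fun n => (coe_le_g0_iff (hw n)).1 (hγ n) x hx

theorem isClosed_solD {s : Y} (hs : s ∈ P.solD) {M : ℝ} (hM : P.g0 s = (M : EReal)) :
    IsClosed P.solD := by
  refine IsSeqClosed.isClosed fun w w' hw hlim => ?_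
  obtain ⟨hmem, hle⟩ := coe_le_g0_of_tendsto (γ := fun _ => M) (fun n => (hw n).1)
    (fun n => by rw [g0_eq_of_mem_solD hs (hw n), hM]) hlim tendsto_const_nhds
  exact ⟨hmem, fun v hv => (hs.2 v hv).trans (hM ▸ hle)⟩

namespace IsProxPoint

variable {σ γ M : ℝ} {y z s : Y}

theorem le_optimal (h : P.IsProxPoint σ y z γ) (hs : s ∈ P.solD) (hM : P.g0 s = (M : EReal)) :
    γ ≤ M := by
  rw [← EReal.coe_le_coe_iff, ← h.g0_eq, ← hM]
  exact hs.2 _ h.mem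

theorem optimal_sub_le (h : P.IsProxPoint σ y z γ) (hs : s ∈ P.solD)
    (hM : P.g0 s = (M : EReal)) : M - γ ≤ inner ℝ (s - z) (z - y) / σ := by
  have := h.le s hs.1
  rw [hM, EReal.coe_le_coe_iff] at this
  linarith

/-- The proximal map is firmly quasi-nonexpansive with respect to the dual solutions. -/
theorem norm_sq_add_norm_sq_le (h : P.IsProxPoint σ y z γ) (hσ : 0 < σ) (hs : s ∈ P.solD)
    (hM : P.g0 s = (M : EReal)) : ‖z - y‖ ^ 2 + ‖z - s‖ ^ 2 ≤ ‖y - s‖ ^ 2 := by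
  have h1 := h.optimal_sub_le hs hM
  have h2 := h.le_optimal hs hM
  have h3 : 0 ≤ inner ℝ (s - z) (z - y) := by
    by_contra! hneg
    have := div_neg_of_neg_of_pos hneg hσ
    linarith
  have h4 : y - s = -((s - z) + (z - y)) := by abel
  rw [h4, norm_neg, norm_add_sq_real, norm_sub_rev s z]
  linarith

theorem norm_sub_le (h : P.IsProxPoint σ y z γ) (hσ : 0 < σ) (hs : s ∈ P.solD)
    (hM : P.g0 s = (M : EReal)) : ‖z - s‖ ≤ ‖y - s‖ := by
  have := h.norm_sq_add_norm_sq_le hσ hs hM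
  exact (sq_le_sq₀ (norm_nonneg _) (norm_nonneg _)).1 (by nlinarith [sq_nonneg ‖z - y‖])

end IsProxPoint

/-- A nonnegative sequence that increases by summable amounts at most converges. -/
theorem exists_tendsto_of_le_add_summable {a ε : ℕ → ℝ} (ha : ∀ k, 0 ≤ a k)
    (hε : ∀ k, 0 ≤ ε k) (hsum : Summable ε) (hle : ∀ k, a (k + 1) ≤ a k + ε k) :
    ∃ l, Tendsto a atTop (𝓝 l) := by
  have hanti : Antitone fun k => a k - ∑ i ∈ Finset.range k, ε i :=
    antitone_nat_of_succ_le fun k => by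
      rw [Finset.sum_range_succ]; linarith [hle k]
  have hbdd : BddBelow (range fun k => a k - ∑ i ∈ Finset.range k, ε i) := by
    refine ⟨-∑' i, ε i, ?_⟩
    rintro _ ⟨k, rfl⟩
    have := hsum.sum_le_tsum (Finset.range k) fun i _ => hε i
    linarith [ha k]
  have h := (tendsto_atTop_ciInf hanti hbdd).add hsum.hasSum.tendsto_sum_nat
  exact ⟨_, by simpa using h⟩

/-- The inexact proximal point algorithm with summable errors converges to a dual solution, and so
do the exact proximal points. -/
theorem exists_tendsto_of_isProxPoint {σ ε γ : ℕ → ℝ} {y z : ℕ → Y} (hσpos : ∀ k, 0 < σ k)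
    (hσmono : Monotone σ) (hε : ∀ k, 0 ≤ ε k) (hsum : Summable ε)
    (hprox : ∀ k, P.IsProxPoint (σ k) (y k) (z k) (γ k))
    (hclose : ∀ k, ‖y (k + 1) - z k‖ ≤ ε k) {s : Y} (hs : s ∈ P.solD) {M : ℝ}
    (hM : P.g0 s = (M : EReal)) :
    ∃ yinf ∈ P.solD, Tendsto y atTop (𝓝 yinf) ∧ Tendsto z atTop (𝓝 yinf) := by
  have hlim : ∀ s' ∈ P.solD, ∃ l, Tendsto (fun k => ‖y k - s'‖) atTop (𝓝 l) := by
    intro s' hs'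
    have hM' : P.g0 s' = (M : EReal) := (g0_eq_of_mem_solD hs hs').trans hM
    refine exists_tendsto_of_le_add_summable (fun k => norm_nonneg _) hε hsum fun k => ?_
    have h1 := (hprox k).norm_sub_le (hσpos k) hs' hM'
    have h2 := norm_sub_le_norm_sub_add_norm_sub (y (k + 1)) (z k) s'
    linarith [hclose k]
  obtain ⟨l, hl⟩ := hlim s hs
  have hε0 : Tendsto ε atTop (𝓝 0) := hsum.tendsto_atTop_zero
  have hzl : Tendsto (fun k => ‖z k - s‖) atTop (𝓝 l) := by
    have hl1 := (hl.comp (tendsto_add_atTop_nat 1)).sub hε0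
    rw [sub_zero] at hl1
    refine tendsto_of_tendsto_of_tendsto_of_le_of_le hl1 hl (fun k => ?_)
      fun k => (hprox k).norm_sub_le (hσpos k) hs hM
    have h2 := norm_sub_le_norm_sub_add_norm_sub (y (k + 1)) (z k) s
    simp only [Function.comp_apply]
    linarith [hclose k]
  have hzy : Tendsto (fun k => ‖z k - y k‖) atTop (𝓝 0) := by
    have h1 : Tendsto (fun k => ‖y k - s‖ ^ 2 - ‖z k - s‖ ^ 2) atTop (𝓝 (l ^ 2 - l ^ 2)) :=
      (hl.pow 2).sub (hzl.pow 2)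
    rw [sub_self] at h1
    have h2 : Tendsto (fun k => ‖z k - y k‖ ^ 2) atTop (𝓝 0) :=
      squeeze_zero (fun k => sq_nonneg _) (fun k => by
        linarith [(hprox k).norm_sq_add_norm_sq_le (hσpos k) hs hM]) h1
    have h3 := h2.sqrt
    simpa [Real.sqrt_sq (norm_nonneg _)] using h3
  have hγ : Tendsto γ atTop (𝓝 M) := by
    have h1 : Tendsto (fun k => M - ‖z k - s‖ * ‖z k - y k‖ / σ 0) atTop (𝓝 (M - l * 0 / σ 0)) :=
      tendsto_const_nhds.sub ((hzl.mul hzy).div_const _)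
    rw [mul_zero, zero_div, sub_zero] at h1
    refine tendsto_of_tendsto_of_tendsto_of_le_of_le h1 tendsto_const_nhds (fun k => ?_)
      fun k => (hprox k).le_optimal hs hM
    have h2 := (hprox k).optimal_sub_le hs hM
    have h3 : inner ℝ (s - z k) (z k - y k) / σ k ≤ ‖z k - s‖ * ‖z k - y k‖ / σ 0 := by
      have hin := real_inner_le_norm (s - z k) (z k - y k)
      rw [norm_sub_rev s] at hin
      exact div_le_div₀ (by positivity) hin (hσpos 0) (hσmono (Nat.zero_le k))
    linarith
  obtain ⟨R, hR⟩ := hl.bddAbove_range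
  have hball : ∀ k, y k ∈ Metric.closedBall s R := fun k => by
    rw [mem_closedBall_iff_norm]; exact hR ⟨k, rfl⟩
  obtain ⟨yinf, -, φ, hφ, hy⟩ := tendsto_subseq_of_bounded Metric.isBounded_closedBall hball
  have hzy' : Tendsto (fun k => z k - y k) atTop (𝓝 0) := tendsto_zero_iff_norm_tendsto_zero.2 hzy
  have hzφ : Tendsto (fun n => z (φ n)) atTop (𝓝 yinf) := by
    have := (hzy'.comp hφ.tendsto_atTop).add hy
    simpa using this
  obtain ⟨hmem, hle⟩ := coe_le_g0_of_tendsto (fun n => (hprox (φ n)).mem)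
    (fun n => (hprox (φ n)).g0_eq.ge) hzφ (hγ.comp hφ.tendsto_atTop)
  have hyinf : yinf ∈ P.solD := ⟨hmem, fun v hv => (hs.2 v hv).trans (hM ▸ hle)⟩
  -- The distances to `yinf` converge, and they tend to `0` along a subsequence.
  obtain ⟨l', hl'⟩ := hlim yinf hyinf
  have hl0 : l' = 0 := by
    refine tendsto_nhds_unique (hl'.comp hφ.tendsto_atTop) ?_
    have := (hy.sub_const yinf).norm
    rwa [sub_self, norm_zero] at this
  have hyt : Tendsto y atTop (𝓝 yinf) := by
    rw [tendsto_iff_norm_sub_tendsto_zero, ← hl0]; exact hl'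
  refine ⟨yinf, hyinf, hyt, ?_⟩
  simpa using hzy'.add hyt

/-! ### The estimates for one step -/

/-- Quadratic growth at the proximal point `z` contracts the distance to the dual solutions. With
`s` the solution nearest to `z`, `κ dist(z)² ≤ g⁰ s - g⁰ z ≤ ‖z - y‖ dist(z) / σ`, so
`σ κ dist(z) ≤ ‖z - y‖`; and `‖z - y‖² + dist(z)² ≤ dist(y)²`. -/
theorem IsProxPoint.infDist_le {σ γ M κ : ℝ} {y z s : Y} (h : P.IsProxPoint σ y z γ)
    (hσ : 0 < σ) (hs : s ∈ P.solD) (hM : P.g0 s = (M : EReal)) (hκ : 0 < κ)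
    (hgrowth : -P.supD + ((κ * Metric.infDist z P.solD ^ 2 : ℝ) : EReal) ≤ -P.g0 z) :
    ‖z - y‖ ≤ Metric.infDist y P.solD ∧
    Metric.infDist z P.solD ≤ Metric.infDist y P.solD / √(1 + σ ^ 2 * κ ^ 2) := by
  have hclosed := isClosed_solD hs hM
  obtain ⟨sy, hsy, hdy⟩ := hclosed.exists_infDist_eq_dist ⟨s, hs⟩ y
  obtain ⟨sz, hsz, hdz⟩ := hclosed.exists_infDist_eq_dist ⟨s, hs⟩ z
  have h1 := h.norm_sq_add_norm_sq_le hσ hsy ((g0_eq_of_mem_solD hs hsy).trans hM)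
  have hz := Metric.infDist_le_dist_of_mem (x := z) hsy
  rw [dist_eq_norm] at hdy hdz hz
  rw [← hdy] at h1
  have h2 := h.optimal_sub_le hsz ((g0_eq_of_mem_solD hs hsz).trans hM)
  have hin := real_inner_le_norm (sz - z) (z - y)
  rw [norm_sub_rev sz, ← hdz] at hin
  have hgr : κ * Metric.infDist z P.solD ^ 2 ≤ M - γ := by
    rw [supD_eq hs, hM, h.g0_eq, ← EReal.coe_neg, ← EReal.coe_neg, ← EReal.coe_add,
      EReal.coe_le_coe_iff] at hgrowth
    linarith
  have hdz0 : 0 ≤ Metric.infDist z P.solD := Metric.infDist_nonneg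
  have hdy0 : 0 ≤ Metric.infDist y P.solD := Metric.infDist_nonneg
  generalize Metric.infDist z P.solD = D at *
  generalize Metric.infDist y P.solD = D' at *
  have h3 : σ * κ * D ≤ ‖z - y‖ := by
    rcases hdz0.eq_or_lt with h0 | hpos
    · rw [← h0, mul_zero]; exact norm_nonneg _
    · have h4 : κ * D ^ 2 ≤ D * ‖z - y‖ / σ :=
        hgr.trans (h2.trans (div_le_div_of_nonneg_right hin hσ.le))
      rw [le_div_iff₀ hσ] at h4
      refine le_of_mul_le_mul_left ?_ hpos
      linarith
  have h5 : D ^ 2 ≤ ‖z - sy‖ ^ 2 := pow_le_pow_left₀ hdz0 hz 2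
  have h6 := pow_le_pow_left₀ (by positivity) h3 2
  refine ⟨(sq_le_sq₀ (norm_nonneg _) hdy0).1 (by nlinarith [sq_nonneg ‖z - sy‖]), ?_⟩
  rw [le_div_iff₀ (by positivity)]
  refine (sq_le_sq₀ (by positivity) hdy0).1 ?_
  rw [mul_pow, Real.sq_sqrt (by positivity)]
  linarith

/-- The error criterion, relative to the step length, turns the bounds for the exact proximal point
`z` into bounds for the update `y⁺`. -/
theorem step_le {V : Type*} [NormedAddCommGroup V] {S : Set V} {y z yplus : V} {η θ : ℝ} (hη0 : 0 ≤ η) (hη1 : η < 1) (hθ : 0 ≤ θ)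
    (hclose : ‖yplus - z‖ ≤ η * ‖yplus - y‖) (hzy : ‖z - y‖ ≤ Metric.infDist y S)
    (hz : Metric.infDist z S ≤ Metric.infDist y S * θ) :
    ‖yplus - y‖ ≤ Metric.infDist y S / (1 - η) ∧
    Metric.infDist yplus S ≤ (η + (η + 1) * θ) / (1 - η) * Metric.infDist y S := by
  have h1η : 0 < 1 - η := sub_pos.2 hη1
  have hstep : ‖yplus - y‖ ≤ Metric.infDist y S / (1 - η) := by
    rw [le_div_iff₀ h1η]
    linarith [norm_sub_le_norm_sub_add_norm_sub yplus z y]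
  refine ⟨hstep, ?_⟩
  have h1 := Metric.infDist_le_infDist_add_dist (s := S) (x := yplus) (y := z)
  rw [dist_eq_norm] at h1
  have h2 : η * ‖yplus - y‖ ≤ η * (Metric.infDist y S / (1 - η)) := by gcongr
  have hd : 0 ≤ Metric.infDist y S := Metric.infDist_nonneg
  have h3 : (η + (η + 1) * θ) / (1 - η) * Metric.infDist y S =
      η * (Metric.infDist y S / (1 - η)) + Metric.infDist y S * θ +
        2 * η * θ * Metric.infDist y S / (1 - η) := by
    field_simp; ring
  have h4 : 0 ≤ 2 * η * θ * Metric.infDist y S / (1 - η) := by positivity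
  linarith

/-- The primal infeasibility is at most the step length divided by `σ`: the Moreau decomposition
gives `q x = d + (y⁺ - y)/σ` with a `d ∈ Q`. -/
theorem norm_proj_q_le {σ : ℝ} (hσ : 0 < σ) (x : X) (y : Y) :
    ‖proj P.Qpolar (P.q x)‖ ≤ ‖P.update σ x y - y‖ / σ := by
  obtain ⟨-, hQ, -⟩ := update_spec σ x y (P := P)
  have h := norm_proj_polarCone_le P.Q (P.q x) (P.Q.smul_mem hQ (inv_nonneg.2 hσ.le))
  have hpt : P.q x - σ⁻¹ • (y + σ • P.q x - P.update σ x y) =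
      σ⁻¹ • (P.update σ x y - y) := by
    rw [smul_sub, smul_add, smul_smul, inv_mul_cancel₀ hσ.ne', one_smul, smul_sub]
    abel
  rw [hpt, norm_smul, Real.norm_of_nonneg (inv_nonneg.2 hσ.le)] at h
  rw [div_eq_inv_mul]
  exact h

theorem abs_inner_update_q_le {σ : ℝ} (hσ : 0 < σ) (x : X) (y : Y) :
    |inner ℝ (P.update σ x y) (P.q x)| ≤
      ‖P.update σ x y‖ * (‖P.update σ x y - y‖ / σ) := by
  obtain ⟨-, -, horth⟩ := update_spec σ x y (P := P)
  have h1 : inner ℝ (P.update σ x y) (P.q x) =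
      inner ℝ (P.update σ x y) (P.update σ x y - y) / σ := by
    rw [inner_sub_right, inner_add_right, real_inner_smul_right] at horth
    rw [inner_sub_right, eq_div_iff hσ.ne']
    linarith
  rw [h1, abs_div, abs_of_pos hσ, ← mul_div_assoc]
  exact div_le_div_of_nonneg_right (abs_real_inner_le_norm _ _) hσ.le

/-- The infimum of `L_σ(·, y)` is at most the primal optimal value, for on the feasible set the
penalty term is nonpositive. -/
theorem iInf_augLag_le_infP {σ : ℝ} (hσ : 0 < σ) (y : Y) :
    (⨅ x, P.augLag σ x y) ≤ P.infP := by
  refine le_iInf₂ fun x hx => (iInf_le _ x).trans ?_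
  by_cases hdom : x ∈ effDom P.f0
  · rw [augLag_eq hdom, f0_eq hdom, EReal.coe_le_coe_iff, realAugLag]
    have h := norm_proj_polarCone_le P.Q (y + σ • P.q x) (P.Q.smul_mem hx hσ.le)
    rw [q, add_sub_cancel_right] at h
    have h2 : ‖P.update σ x y‖ ^ 2 ≤ ‖y‖ ^ 2 := pow_le_pow_left₀ (norm_nonneg _) h 2
    have h3 : 1 / (2 * σ) * (‖P.update σ x y‖ ^ 2 - ‖y‖ ^ 2) ≤ 0 :=
      mul_nonpos_of_nonneg_of_nonpos (by positivity) (by linarith)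
    linarith
  · have : P.f0 x = ⊤ := by simpa [effDom] using hdom
    rw [this]; exact le_top

theorem f0_le_infP_add {σ δ : ℝ} (hσ : 0 < σ) {x : X} {y : Y}
    (hle : P.augLag σ x y ≤ (⨅ u, P.augLag σ u y) + (δ : EReal)) :
    P.f0 x ≤ P.infP +
      ((δ + (‖y‖ ^ 2 - ‖P.update σ x y‖ ^ 2) / (2 * σ) : ℝ) : EReal) := by
  by_cases hne : P.infP = ⊤
  · rw [hne, EReal.top_add_coe]; exact le_top
  have h1 := hle.trans (add_le_add_left (iInf_augLag_le_infP hσ y) (δ : EReal))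
  have hdom : x ∈ effDom P.f0 := by
    by_contra hn
    rw [augLag_eq_top hn, top_le_iff] at h1
    exact (EReal.add_lt_top hne (EReal.coe_ne_top _)).ne h1
  rw [augLag_eq hdom] at h1
  have h2 : P.f0 x = (P.realAugLag σ x y : EReal) +
      (((‖y‖ ^ 2 - ‖P.update σ x y‖ ^ 2) / (2 * σ) : ℝ) : EReal) := by
    rw [f0_eq hdom, ← EReal.coe_add, realAugLag]
    congr 1
    field_simp; ring
  rw [h2, EReal.coe_add, ← add_assoc]
  exact add_le_add_left h1 _

/-- The excess over the optimal value in the gap estimate is a multiple of the step length. -/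
theorem gap_le {V : Type*} [NormedAddCommGroup V] {σ η : ℝ} (hσ : 0 < σ) (hη1 : η < 1)
    {y yplus : V} {d : ℝ}
    (hstep : ‖yplus - y‖ ≤ d / (1 - η)) :
    η ^ 2 / (2 * σ) * ‖yplus - y‖ ^ 2 + (‖y‖ ^ 2 - ‖yplus‖ ^ 2) / (2 * σ) ≤
      rateGap η σ y yplus * d := by
  have h1η : 0 < 1 - η := sub_pos.2 hη1
  have h1 : ‖y‖ ^ 2 - ‖yplus‖ ^ 2 ≤ (‖yplus‖ + ‖y‖) * ‖yplus - y‖ := by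
    have := norm_sub_norm_le y yplus
    rw [norm_sub_rev] at this
    have h0 : 0 ≤ ‖yplus‖ + ‖y‖ := by positivity
    nlinarith
  calc η ^ 2 / (2 * σ) * ‖yplus - y‖ ^ 2 + (‖y‖ ^ 2 - ‖yplus‖ ^ 2) / (2 * σ)
      ≤ η ^ 2 / (2 * σ) * ‖yplus - y‖ ^ 2 + (‖yplus‖ + ‖y‖) * ‖yplus - y‖ / (2 * σ) := by
        gcongr
    _ = (η ^ 2 * ‖yplus - y‖ + ‖yplus‖ + ‖y‖) / (2 * σ) * ‖yplus - y‖ := by ring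
    _ ≤ (η ^ 2 * ‖yplus - y‖ + ‖yplus‖ + ‖y‖) / (2 * σ) * (d / (1 - η)) := by gcongr
    _ = rateGap η σ y yplus * d := by rw [rateGap]; field_simp

end CCCP

/-! ### Limits of the coefficients -/

section Coefficients

variable {V : Type*} [NormedAddCommGroup V] {η σ : ℕ → ℝ}

theorem tendsto_rateDual {κ σinf : ℝ} (hη : Tendsto η atTop (𝓝 0))
    (hσ : Tendsto σ atTop (𝓝 σinf)) :
    Tendsto (fun k => rateDual (η k) (σ k) κ) atTop (𝓝 (1 / √(1 + σinf ^ 2 * κ ^ 2))) := by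
  have hne : √(1 + σinf ^ 2 * κ ^ 2) ≠ 0 := (Real.sqrt_pos.2 (by positivity)).ne'
  have h := (hη.add ((hη.add_const 1).div
    (((hσ.pow 2).mul_const (κ ^ 2)).const_add 1).sqrt hne)).div
    (hη.const_sub 1) (by norm_num)
  simp only [sub_zero, zero_add, div_one] at h
  exact h

theorem tendsto_rateFeas {σinf : ℝ} (hη : Tendsto η atTop (𝓝 0))
    (hσ : Tendsto σ atTop (𝓝 σinf)) (hpos : 0 < σinf) :
    Tendsto (fun k => rateFeas (η k) (σ k)) atTop (𝓝 (1 / σinf)) := by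
  have h := (tendsto_const_nhds (x := (1 : ℝ))).div ((hη.const_sub 1).mul hσ)
    (by simpa using hpos.ne')
  simp only [sub_zero, one_mul] at h
  exact h

theorem tendsto_rateCompl {σinf : ℝ} {u : ℕ → V} {v : V} (hη : Tendsto η atTop (𝓝 0))
    (hσ : Tendsto σ atTop (𝓝 σinf)) (hpos : 0 < σinf) (hu : Tendsto u atTop (𝓝 v)) :
    Tendsto (fun k => rateCompl (η k) (σ k) (u k)) atTop (𝓝 (‖v‖ / σinf)) := by
  have h := hu.norm.div ((hη.const_sub 1).mul hσ) (by simpa using hpos.ne')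
  simp only [sub_zero, one_mul] at h
  exact h

theorem tendsto_rateGap_numerator {u w : ℕ → V} {v : V} (hη : Tendsto η atTop (𝓝 0))
    (hu : Tendsto u atTop (𝓝 v)) (hw : Tendsto w atTop (𝓝 v)) :
    Tendsto (fun k => η k ^ 2 * ‖w k - u k‖ + ‖w k‖ + ‖u k‖) atTop (𝓝 (‖v‖ + ‖v‖)) := by
  simpa using (((hη.pow 2).mul (hw.sub hu).norm).add hw.norm).add hu.norm

theorem tendsto_rateGap {σinf : ℝ} {u w : ℕ → V} {v : V} (hη : Tendsto η atTop (𝓝 0))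
    (hσ : Tendsto σ atTop (𝓝 σinf)) (hpos : 0 < σinf) (hu : Tendsto u atTop (𝓝 v))
    (hw : Tendsto w atTop (𝓝 v)) :
    Tendsto (fun k => rateGap (η k) (σ k) (u k) (w k)) atTop (𝓝 (‖v‖ / σinf)) := by
  have h := (tendsto_rateGap_numerator hη hu hw).div (((hη.const_sub 1).const_mul 2).mul hσ)
    (by simpa using hpos.ne')
  have he : (‖v‖ + ‖v‖) / (2 * (1 - 0) * σinf) = ‖v‖ / σinf := by
    field_simp; ring
  rw [he] at h
  exact h

theorem tendsto_rateDual_atTop {κ : ℝ} (hκ : 0 < κ) (hη : Tendsto η atTop (𝓝 0))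
    (hσ : Tendsto σ atTop atTop) :
    Tendsto (fun k => rateDual (η k) (σ k) κ) atTop (𝓝 0) := by
  have hσκ : Tendsto (fun k => √(1 + σ k ^ 2 * κ ^ 2)) atTop atTop := by
    refine tendsto_atTop_mono (fun k => ?_) (hσ.atTop_mul_const hκ)
    refine Real.le_sqrt_of_sq_le ?_
    rw [mul_pow]; linarith
  have h := (hη.add ((hη.add_const 1).div_atTop hσκ)).div (hη.const_sub 1) (by norm_num)
  simp only [sub_zero, zero_add, div_one] at h
  exact h

theorem tendsto_one_sub_mul_atTop (hη : Tendsto η atTop (𝓝 0)) (hσ : Tendsto σ atTop atTop) :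
    Tendsto (fun k => (1 - η k) * σ k) atTop atTop := by
  have h := hη.const_sub 1
  rw [sub_zero] at h
  exact h.pos_mul_atTop one_pos hσ

theorem tendsto_rateFeas_atTop (hη : Tendsto η atTop (𝓝 0)) (hσ : Tendsto σ atTop atTop) :
    Tendsto (fun k => rateFeas (η k) (σ k)) atTop (𝓝 0) :=
  tendsto_const_nhds.div_atTop (tendsto_one_sub_mul_atTop hη hσ)

theorem tendsto_rateCompl_atTop {u : ℕ → V} {v : V} (hη : Tendsto η atTop (𝓝 0))
    (hσ : Tendsto σ atTop atTop) (hu : Tendsto u atTop (𝓝 v)) :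
    Tendsto (fun k => rateCompl (η k) (σ k) (u k)) atTop (𝓝 0) :=
  hu.norm.div_atTop (tendsto_one_sub_mul_atTop hη hσ)

theorem tendsto_rateGap_atTop {u w : ℕ → V} {v : V} (hη : Tendsto η atTop (𝓝 0))
    (hσ : Tendsto σ atTop atTop) (hu : Tendsto u atTop (𝓝 v)) (hw : Tendsto w atTop (𝓝 v)) :
    Tendsto (fun k => rateGap (η k) (σ k) (u k) (w k)) atTop (𝓝 0) := by
  refine (tendsto_rateGap_numerator hη hu hw).div_atTop ?_
  simpa only [mul_assoc] using (tendsto_one_sub_mul_atTop hη hσ).const_mul_atTop two_pos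

theorem isLittleO_of_eventually_norm_le {f r d : ℕ → ℝ} (hr : Tendsto r atTop (𝓝 0))
    (hd : ∀ k, 0 ≤ d k) (h : ∀ᶠ k in atTop, ‖f k‖ ≤ r k * d k) : f =o[atTop] d := by
  refine IsLittleO.of_bound fun c hc => ?_
  filter_upwards [h, hr.eventually_le_const hc] with k hk hrk
  rw [Real.norm_of_nonneg (hd k)]
  exact hk.trans (mul_le_mul_of_nonneg_right hrk (hd k))

end Coefficients

end

/-! ### Convergence and rates of the augmented Lagrangian method -/

theorem theorem1 {X Y W : Type*}
    [NormedAddCommGroup X] [InnerProductSpace ℝ X] [FiniteDimensional ℝ X]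
    [NormedAddCommGroup Y] [InnerProductSpace ℝ Y] [FiniteDimensional ℝ Y]
    [NormedAddCommGroup W] [InnerProductSpace ℝ W] [FiniteDimensional ℝ W]
    (P : CCCP X Y W) (hKKT : ∃ xbar ybar, P.IsKKT xbar ybar)
    (σ : ℕ → ℝ) (hσpos : ∀ k, 0 < σ k) (hσmono : Monotone σ)
    (x : ℕ → X) (y : ℕ → Y) (hALM : P.IsALM σ x y)
    (ε : ℕ → ℝ) (hA : P.CritA σ x y ε) :
    Bornology.IsBounded (range y) ∧
    ∃ yinf ∈ P.solD, Tendsto y atTop (𝓝 yinf) ∧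
      ∀ (η : ℕ → ℝ) (κg : ℝ), P.CritB σ x y η → P.DualQuadGrowth yinf κg →
        -- the four estimates
        (∃ kbar : ℕ, ∀ k ≥ kbar,
          Metric.infDist (y (k + 1)) P.solD
              ≤ rateDual (η k) (σ k) κg * Metric.infDist (y k) P.solD ∧
          ‖proj P.Qpolar (P.B (x (k + 1)) - P.b)‖
              ≤ rateFeas (η k) (σ k) * Metric.infDist (y k) P.solD ∧
          |inner ℝ (y (k + 1)) (P.B (x (k + 1)) - P.b)|
              ≤ rateCompl (η k) (σ k) (y (k + 1)) * Metric.infDist (y k) P.solD ∧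
          P.f0 (x (k + 1))
              ≤ P.infP + ((rateGap (η k) (σ k) (y k) (y (k + 1)) *
                  Metric.infDist (y k) P.solD : ℝ) : EReal)) ∧
        -- the limits of the coefficients when the penalty parameters have a finite limit
        (∀ σinf : ℝ, Tendsto σ atTop (𝓝 σinf) →
          Tendsto (fun k => rateDual (η k) (σ k) κg) atTop
            (𝓝 (1 / √(1 + σinf ^ 2 * κg ^ 2))) ∧
          Tendsto (fun k => rateFeas (η k) (σ k)) atTop (𝓝 (1 / σinf)) ∧
          Tendsto (fun k => rateCompl (η k) (σ k) (y (k + 1))) atTop (𝓝 (‖yinf‖ / σinf)) ∧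
          Tendsto (fun k => rateGap (η k) (σ k) (y k) (y (k + 1))) atTop
            (𝓝 (‖yinf‖ / σinf))) ∧
        -- the case of penalty parameters that tend to infinity
        (Tendsto σ atTop atTop →
          (Tendsto (fun k => rateDual (η k) (σ k) κg) atTop (𝓝 0) ∧
          Tendsto (fun k => rateFeas (η k) (σ k)) atTop (𝓝 0) ∧
          Tendsto (fun k => rateCompl (η k) (σ k) (y (k + 1))) atTop (𝓝 0) ∧
          Tendsto (fun k => rateGap (η k) (σ k) (y k) (y (k + 1))) atTop (𝓝 0)) ∧
          (fun k => Metric.infDist (y (k + 1)) P.solD)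
            =o[atTop] (fun k => Metric.infDist (y k) P.solD) ∧
          (fun k => ‖proj P.Qpolar (P.B (x (k + 1)) - P.b)‖)
            =o[atTop] (fun k => Metric.infDist (y k) P.solD) ∧
          (fun k => (inner ℝ (y (k + 1)) (P.B (x (k + 1)) - P.b) : ℝ))
            =o[atTop] (fun k => Metric.infDist (y k) P.solD) ∧
          ∀ δ : ℝ, 0 < δ → ∀ᶠ k in atTop,
            P.f0 (x (k + 1))
              ≤ P.infP + ((δ * Metric.infDist (y k) P.solD : ℝ) : EReal)) := by
  obtain ⟨xbar, s, hkkt⟩ := hKKT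
  obtain ⟨hs, hxbar, hM⟩ := hkkt.dual_optimal
  obtain ⟨hε, hεsum, hεle⟩ := hA
  have hupd : ∀ k, y (k + 1) = P.update (σ k) (x (k + 1)) (y k) := hALM.2
  choose z γ hprox hstab using fun k =>
    CCCP.exists_isProxPoint (hσpos k) hxbar hs.1 hM.ge (y k)
  have hclose : ∀ k, ‖y (k + 1) - z k‖ ≤ ε k := fun k => by
    rw [hupd]; exact hstab k _ _ (hε k) (hεle k)
  obtain ⟨yinf, hyinf, hylim, hzlim⟩ :=
    CCCP.exists_tendsto_of_isProxPoint hσpos hσmono hε hεsum hprox hclose hs hM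
  refine ⟨Metric.isBounded_range_of_tendsto y hylim, yinf, hyinf, hylim, ?_⟩
  rintro η κ ⟨hη, hηsum, hηle⟩ ⟨hκ, r, hr, hgrowth⟩
  have hη0 : Tendsto η atTop (𝓝 0) := hηsum.tendsto_atTop_zero
  have hylim' : Tendsto (fun k => y (k + 1)) atTop (𝓝 yinf) :=
    hylim.comp (tendsto_add_atTop_nat 1)
  have hd0 : ∀ k, 0 ≤ Metric.infDist (y k) P.solD := fun k => Metric.infDist_nonneg
  have hest : ∀ᶠ k in atTop,
      Metric.infDist (y (k + 1)) P.solD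
          ≤ rateDual (η k) (σ k) κ * Metric.infDist (y k) P.solD ∧
      ‖proj P.Qpolar (P.B (x (k + 1)) - P.b)‖
          ≤ rateFeas (η k) (σ k) * Metric.infDist (y k) P.solD ∧
      |inner ℝ (y (k + 1)) (P.B (x (k + 1)) - P.b)|
          ≤ rateCompl (η k) (σ k) (y (k + 1)) * Metric.infDist (y k) P.solD ∧
      P.f0 (x (k + 1))
          ≤ P.infP + ((rateGap (η k) (σ k) (y k) (y (k + 1)) *
              Metric.infDist (y k) P.solD : ℝ) : EReal) := by
    -- Quadratic growth is needed at the exact proximal points `zᵏ`, which also tend to `yinf`.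
    filter_upwards [hzlim.eventually (Metric.closedBall_mem_nhds yinf hr)] with k hzk
    have hσk := hσpos k
    obtain ⟨hη0k, hη1k⟩ := hη k
    have h1η : 0 < 1 - η k := sub_pos.2 hη1k
    have hfeas : z k ∈ P.feasD :=
      ⟨by rw [(hprox k).g0_eq, ← EReal.coe_neg]; exact EReal.coe_lt_top _, (hprox k).mem⟩
    obtain ⟨hzy, hzS⟩ := (hprox k).infDist_le hσk hs hM hκ (hgrowth _ ⟨hfeas, hzk⟩)
    have hcloseB : ‖y (k + 1) - z k‖ ≤ η k * ‖y (k + 1) - y k‖ := by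
      conv_lhs => rw [hupd]
      refine hstab k _ _ (by positivity) ((hηle k).trans_eq ?_)
      congr 2
      ring
    rw [← mul_one_div] at hzS
    obtain ⟨hstep, hdual⟩ := CCCP.step_le hη0k hη1k (by positivity) hcloseB hzy hzS
    have hstepσ : ‖y (k + 1) - y k‖ / σ k ≤
        rateFeas (η k) (σ k) * Metric.infDist (y k) P.solD := by
      refine (div_le_div_of_nonneg_right hstep hσk.le).trans_eq ?_
      rw [rateFeas]; field_simp
    refine ⟨?_, ?_, ?_, ?_⟩
    · rwa [mul_one_div] at hdual
    · have h := CCCP.norm_proj_q_le hσk (x (k + 1)) (y k) (P := P)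
      rw [← hupd] at h
      exact h.trans hstepσ
    · have h := CCCP.abs_inner_update_q_le hσk (x (k + 1)) (y k) (P := P)
      rw [← hupd] at h
      refine h.trans ((mul_le_mul_of_nonneg_left hstepσ (norm_nonneg _)).trans_eq ?_)
      rw [rateFeas, rateCompl]; ring
    · have h := CCCP.f0_le_infP_add hσk (hηle k)
      rw [← hupd] at h
      exact h.trans (add_le_add_right (EReal.coe_le_coe_iff.2 (CCCP.gap_le hσk hη1k hstep)) _)
  refine ⟨eventually_atTop.1 hest, fun σinf hσinf => ?_, fun hσinf => ?_⟩
  · have hpos : 0 < σinf := (hσpos 0).trans_le (hσmono.ge_of_tendsto hσinf 0)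
    exact ⟨tendsto_rateDual hη0 hσinf, tendsto_rateFeas hη0 hσinf hpos,
      tendsto_rateCompl hη0 hσinf hpos hylim', tendsto_rateGap hη0 hσinf hpos hylim hylim'⟩
  · have hr1 := tendsto_rateDual_atTop hκ hη0 hσinf
    have hr2 := tendsto_rateFeas_atTop hη0 hσinf
    have hr3 := tendsto_rateCompl_atTop hη0 hσinf hylim'
    have hr4 := tendsto_rateGap_atTop hη0 hσinf hylim hylim'
    refine ⟨⟨hr1, hr2, hr3, hr4⟩, isLittleO_of_eventually_norm_le hr1 hd0 ?_,
      isLittleO_of_eventually_norm_le hr2 hd0 ?_, isLittleO_of_eventually_norm_le hr3 hd0 ?_,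
      fun δ hδ => ?_⟩
    · exact hest.mono fun k hk => by
        rw [Real.norm_of_nonneg (hd0 (k + 1))]; exact hk.1
    · exact hest.mono fun k hk => by rw [norm_norm]; exact hk.2.1
    · exact hest.mono fun k hk => hk.2.2.1
    · filter_upwards [hest, hr4.eventually_le_const hδ] with k hk hrk
      exact hk.2.2.2.trans (add_le_add_right
        (EReal.coe_le_coe_iff.2 (mul_le_mul_of_nonneg_right hrk (hd0 k))) _)
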